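/- Multigraphs are finite and loopless (parallel edges are allowed), and the degree of a vertex is the number of edges incident with it. For an integer $d \ge 1$, an edge colouring of a multigraph $G$ with defect $d$ is a colouring of its edges in which each vertex is incident with at most $d$ edges of the same colour; the $d$-defective chromatic index $\chi'_d(G)$ is the minimum $k$ such that $G$ has an edge colouring with defect $d$ using at most $k$ colours. For an integer $k \ge 1$, the Shannon multigraph $Sh(k)$ has three vertices, whose three pairs are joined by $\lfloor k/2\rfloor$, $\lfloor k/2\rfloor$ and $\lceil k/2\rceil$ parallel edges respectively. Theorem. Let $d, \Delta \ge 1$ be integers and let $G$ be a multigraph with maximum degree $\Delta$. If $d$ is even, then $\chi'_d(G) = \lceil \frac{\Delta}{d} \rceil$. If $d$ is odd, then $\chi'_d(G) \le \lceil \frac{3\Delta-1}{3d-1} \rceil$, and this bound is tight for all $\Delta \ge 1$ and all odd $d \ge 1$: the Shannon multigraph $Sh(\Delta)$ has maximum degree $\Delta$ and $\chi'_d(Sh(\Delta)) = \lceil \frac{3\Delta-1}{3d-1} \rceil$. -/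

import Mathlib

/-! Multigraphs are Mathlib's `Graph α β`, where `G.vertexSet : Set α`, `G.edgeSet : Set β` and
`G.Inc e v` says that the edge `e` is incident with the vertex `v`. The multigraphs considered here
are finite (finite vertex set, finite edge set) and without loops (`Graph.Loopless`); parallel
edges are allowed. -/

namespace Graph

/-- The degree of a vertex of a finite loopless multigraph: the number of edges incident with it
(parallel edges are counted separately). -/
noncomputable def degree {α β : Type*} (G : Graph α β) (v : α) : ℕ :=
  {e : β | G.Inc e v}.ncard

/-- `G` has maximum degree `Δ`: the number `Δ` is the largest of the degrees of its vertices. -/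
def HasMaxDegree {α β : Type*} (G : Graph α β) (Δ : ℕ) : Prop :=
  IsGreatest (G.degree '' G.vertexSet) Δ

/-- An edge colouring of `G` with defect `d` (for `G` finite): each vertex is incident with at most
`d` edges of the same colour. -/
def IsDefectiveEdgeColouring {α β C : Type*} (G : Graph α β) (d : ℕ) (c : G.edgeSet → C) : Prop :=
  ∀ v ∈ G.vertexSet, ∀ i : C, {e : G.edgeSet | G.Inc e v ∧ c e = i}.ncard ≤ d

/-- `G` is `(k, d)`-edge colourable: it has an edge colouring with defect `d` that uses at most
`k` colours. -/
def DefectiveEdgeColourable {α β : Type*} (G : Graph α β) (k d : ℕ) : Prop :=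
  ∃ c : G.edgeSet → Fin k, G.IsDefectiveEdgeColouring d c

/-- The `d`-defective chromatic index of `G`: the minimum `k` such that `G` is `(k, d)`-edge
colourable (and `⊤` if there is no such `k`). -/
noncomputable def defectiveChromaticIndex {α β : Type*} (G : Graph α β) (d : ℕ) : ℕ∞ :=
  ⨅ k ∈ {k : ℕ | G.DefectiveEdgeColourable k d}, (k : ℕ∞)

/-- The numbers of parallel edges of the Shannon multigraph: `⌊k/2⌋`, `⌊k/2⌋` and `⌈k/2⌉`. -/
def shannonMultiplicity (k : ℕ) : Fin 3 → ℕ :=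
  ![k / 2, k / 2, (k + 1) / 2]

/-- The Shannon multigraph `Sh(k)`: three vertices `0, 1, 2`, whose three pairs are joined by
`⌊k/2⌋`, `⌊k/2⌋` and `⌈k/2⌉` parallel edges respectively. The edge `⟨i, j⟩` joins the vertices
`i` and `i + 1` (addition modulo `3`). -/
def shannon (k : ℕ) : Graph (Fin 3) (Σ i : Fin 3, Fin (shannonMultiplicity k i)) where
  vertexSet := Set.univ
  IsLink e x y := s(x, y) = s(e.1, e.1 + 1)
  edgeSet := Set.univ
  isLink_symm e _ := ⟨fun x y h => by rw [Sym2.eq_swap]; exact h⟩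
  eq_or_eq_of_isLink_of_isLink e x y v w h h' := by
    have := h.trans h'.symm
    rw [Sym2.eq_iff] at this
    tauto
  edge_mem_iff_exists_isLink e := ⟨fun _ => ⟨_, _, rfl⟩, fun _ => Set.mem_univ _⟩
  left_mem_of_isLink _ _ _ _ := Set.mem_univ _

end Graph

/-! ### Closed trails as orbits of dart involutions -/

section Darts

open scoped Classical

/-! The lower bounds are counts; the upper bounds extend a partial colouring one edge at a time.

Let e = xy be uncoloured, with room for a colour α at x and a colour β at y. If α = β, then e takes
it. Otherwise the edges coloured α or β, together with e, form a graph of maximum degree at most 2d.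
Alternating along Eulerian closed trails splits it into two graphs of maximum degree at most d,
unless some 2d-regular union of components has an odd number d|S| of edges (`exists_split`). For
even d this never happens, so kd ≥ Δ suffices.

For odd d, a stuck edge makes each colour with room at x or y have room for exactly one edge there,
and no colour has room at both (`IsDefective.exists_closed`). Some α-edge f = yz has z ≠ x. Moving α
from f to e leaves f stuck instead. A parity argument shows that only α can have room at x before
the move and at z after it. The three sets of colours with room at x, y, z have at least kd − Δ + 1
elements each, and their only overlap is α, so 3(kd − Δ + 1) ≤ k + 1. This fails as soon as k ≥ (3Δ
− 1)/(3d − 1) (`IsDefective.exists_extend`).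

For odd d a colour class of the Shannon multigraph has at most (3d − 1)/2 edges, out of at least (3Δ
− 1)/2 in all. -/

theorem Finset.even_card_of_involution {D : Type*} (S : Finset D) (f : D → D)
    (hS : ∀ x ∈ S, f x ∈ S) (hf : ∀ x ∈ S, f (f x) = x) (hne : ∀ x ∈ S, f x ≠ x) :
    Even S.card := by
  have h : ∑ _x ∈ S, (1 : ZMod 2) = 0 :=
    Finset.sum_involution (fun x _ => f x) (fun _ _ => by decide) (fun x hx _ => hne x hx)
      (fun x hx => hS x hx) (fun x hx => hf x hx)
  simp only [Finset.sum_const, nsmul_eq_mul, mul_one] at h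
  exact (ZMod.natCast_eq_zero_iff_even).1 h

theorem exists_involution_of_even_card {D : Type*} [Fintype D] (h : Even (Fintype.card D)) :
    ∃ f : D → D, (∀ x, f (f x) = x) ∧ ∀ x, f x ≠ x := by
  obtain ⟨m, hm⟩ := h
  have e : D ≃ Fin m × Bool := Fintype.equivOfCardEq (by simp [hm]; omega)
  refine ⟨fun x => e.symm ((e x).1, !(e x).2), fun x => by simp, fun x hx => ?_⟩
  have := congrArg (fun y => (e y).2) hx
  simp at this

/-- Two darts are linked if one can get from one to the other by repeatedly applying the edge
reversal `θ` and the pairing `π`. -/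
def Linked {D : Type*} (θ π : D → D) : D → D → Prop :=
  Relation.EqvGen fun a b => b = θ a ∨ b = π a

theorem Linked.equivalence {D : Type*} (θ π : D → D) : Equivalence (Linked θ π) :=
  Relation.EqvGen.is_equivalence _

theorem Linked.left {D : Type*} (θ π : D → D) (x : D) : Linked θ π x (θ x) :=
  .rel _ _ (Or.inl rfl)

theorem Linked.right {D : Type*} (θ π : D → D) (x : D) : Linked θ π x (π x) :=
  .rel _ _ (Or.inr rfl)

theorem Linked.mono_of {D : Type*} {θ π : D → D} {r : D → D → Prop} (hr : Equivalence r)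
    (h₁ : ∀ x, r x (θ x)) (h₂ : ∀ x, r x (π x)) {x y : D} (h : Linked θ π x y) : r x y := by
  induction h with
  | rel a b h => rcases h with rfl | rfl; exacts [h₁ _, h₂ _]
  | refl a => exact hr.refl a
  | symm _ _ _ ih => exact hr.symm ih
  | trans _ _ _ _ _ ih₁ ih₂ => exact hr.trans ih₁ ih₂

/-- Rewiring two closed trails at a common vertex joins them. Cutting the pair x, `π x` opens the
trail of x into a path whose other end can only be `π x`, so no old link is lost. -/
theorem Linked.exists_merge {D V : Type*} [Fintype D] {θ π : D → D} {f : D → V}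
    (hθ : ∀ x, θ (θ x) = x) (hθ' : ∀ x, θ x ≠ x)
    (hπ : ∀ x, π (π x) = x) (hπ' : ∀ x, π x ≠ x) (hf : ∀ x, f (π x) = f x)
    {x y : D} (hxy : f x = f y) (hn : ¬ Linked θ π x y) :
    ∃ ρ : D → D, (∀ x, ρ (ρ x) = x) ∧ (∀ x, ρ x ≠ x) ∧ (∀ x, f (ρ x) = f x) ∧
      (∀ a b, Linked θ π a b → Linked θ ρ a b) ∧ Linked θ ρ x y := by
  have hinj : ∀ a b, π a = π b → a = b := fun a b h => by rw [← hπ a, h, hπ]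
  have E := Linked.equivalence θ π
  have n1 : x ≠ y := fun h => hn (h ▸ E.refl x)
  have n2 : π x ≠ y := fun h => hn (h ▸ Linked.right θ π x)
  have n3 : π y ≠ x := fun h => n2 (by rw [← h, hπ])
  have n4 : π x ≠ π y := fun h => n1 (hinj _ _ h)
  -- Conjugating by this swap replaces the pairs {x, π x}, {y, π y} by {x, y}, {π x, π y}.
  let τ := Equiv.swap (π x) y
  have hτ : ∀ z, τ (τ z) = z := fun z => Equiv.swap_apply_self _ _ _
  have τl : τ (π x) = y := Equiv.swap_apply_left _ _
  have τr : τ y = π x := Equiv.swap_apply_right _ _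
  have τn : ∀ z, z ≠ π x → z ≠ y → τ z = z := fun z h h' => Equiv.swap_apply_of_ne_of_ne h h'
  have fτ : ∀ z, f (τ z) = f z := by
    intro z
    by_cases h : z = π x
    · rw [h, τl, hf, hxy]
    by_cases h' : z = y
    · rw [h', τr, hf, hxy]
    rw [τn z h h']
  let ρ := fun z => τ (π (τ z))
  have ρx : ρ x = y := by
    simp only [ρ]; rw [τn x (hπ' x).symm n1, τl]
  have ρy : ρ (π x) = π y := by
    simp only [ρ]; rw [τl, τn _ n4.symm (hπ' y)]
  have ρn : ∀ z, z ≠ x → z ≠ π x → z ≠ y → z ≠ π y → ρ z = π z := by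
    intro z h1 h2 h3 h4
    simp only [ρ]
    rw [τn z h2 h3, τn]
    · exact fun h => h1 (hinj _ _ h)
    · exact fun h => h4 (by rw [← h, hπ])
  have E' := Linked.equivalence θ ρ
  have lxy : Linked θ ρ x y := by simpa [ρx] using Linked.right θ ρ x
  have lxy' : Linked θ ρ (π x) (π y) := by simpa [ρy] using Linked.right θ ρ (π x)
  have key : Linked θ ρ x (π x) := by
    by_contra hc
    -- `θ` pairs off all of `S`. If `π x` is not reached, `ρ` agrees with `π` on `S` except at x, so
    -- `π` pairs off `S` without x: the parities clash.
    let S : Finset D := Finset.univ.filter fun z => Linked θ ρ x z ∧ Linked θ π x z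
    have hxS : x ∈ S := by simp [S, E.refl, E'.refl]
    have h1 : Even S.card := by
      refine S.even_card_of_involution θ (fun z hz => ?_) (fun z _ => hθ z) (fun z _ => hθ' z)
      simp only [S, Finset.mem_filter, Finset.mem_univ, true_and] at hz ⊢
      exact ⟨E'.trans hz.1 (Linked.left _ _ _), E.trans hz.2 (Linked.left _ _ _)⟩
    have h2 : Even (S.erase x).card := by
      refine (S.erase x).even_card_of_involution π (fun z hz => ?_) (fun z _ => hπ z)
        (fun z _ => hπ' z)
      simp only [S, Finset.mem_erase, Finset.mem_filter, Finset.mem_univ, true_and] at hz ⊢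
      obtain ⟨h1, h2, h3⟩ := hz
      have zx : z ≠ π x := fun h => hc (h ▸ h2)
      have zy : z ≠ y := fun h => hn (h ▸ h3)
      have zy' : z ≠ π y := fun h => hn (E.trans (h ▸ h3) (E.symm (Linked.right _ _ _)))
      have hz : ρ z = π z := ρn z h1 zx zy zy'
      refine ⟨fun h => zx (by rw [← h, hπ]), ?_, E.trans h3 (Linked.right _ _ _)⟩
      rw [← hz]
      exact E'.trans h2 (Linked.right _ _ _)
    rw [Finset.card_erase_of_mem hxS] at h2
    have := Finset.card_pos.2 ⟨x, hxS⟩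
    obtain ⟨a, ha⟩ := h1
    obtain ⟨b, hb⟩ := h2
    omega
  have key' : Linked θ ρ y (π y) := E'.trans (E'.trans (E'.symm lxy) key) lxy'
  refine ⟨ρ, fun z => by simp only [ρ, hτ, hπ], fun z h => ?_, fun z => ?_, fun a b => ?_, lxy⟩
  · apply hπ' (τ z)
    have := congrArg τ h
    simpa only [ρ, hτ] using this
  · simp only [ρ, fτ, hf]
  · refine Linked.mono_of E' (Linked.left _ _) fun z => ?_
    by_cases z1 : z = x
    · rwa [z1]
    by_cases z2 : z = π x
    · rw [z2, hπ]; exact E'.symm key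
    by_cases z3 : z = y
    · rwa [z3]
    by_cases z4 : z = π y
    · rw [z4, hπ]; exact E'.symm key'
    rw [← ρn z z1 z2 z3 z4]
    exact Linked.right _ _ _

/-- Even degrees allow some pairing of the darts at each vertex. One with the most linked pairs
admits no merge, so each component is a single Eulerian closed trail. -/
theorem exists_linked_pairing {D V : Type*} [Fintype D] {θ : D → D} {f : D → V}
    (hθ : ∀ x, θ (θ x) = x) (hθ' : ∀ x, θ x ≠ x)
    (hf : ∀ v, Even (Finset.univ.filter fun x => f x = v).card) :
    ∃ π : D → D, (∀ x, π (π x) = x) ∧ (∀ x, π x ≠ x) ∧ (∀ x, f (π x) = f x) ∧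
      ∀ x y, f x = f y → Linked θ π x y := by
  let P : Set (D → D) := {π | (∀ x, π (π x) = x) ∧ (∀ x, π x ≠ x) ∧ ∀ x, f (π x) = f x}
  have hP : P.Nonempty := by
    have : ∀ v, ∃ g : {x // f x = v} → {x // f x = v}, (∀ x, g (g x) = x) ∧ ∀ x, g x ≠ x :=
      fun v => exists_involution_of_even_card (by rw [Fintype.card_subtype]; exact hf v)
    choose g hg hg' using this
    have hv : ∀ (v : V) (x : D) (h : f x = v), (g (f x) ⟨x, rfl⟩ : D) = g v ⟨x, h⟩ := by
      rintro v x rfl; rfl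
    refine ⟨fun x => g (f x) ⟨x, rfl⟩, fun x => ?_, fun x h => ?_, fun x => ?_⟩
    · have := hv (f x) _ (g (f x) ⟨x, rfl⟩).2
      exact this.trans (congrArg Subtype.val (hg (f x) ⟨x, rfl⟩))
    · exact hg' (f x) ⟨x, rfl⟩ (Subtype.ext h)
    · exact (g (f x) ⟨x, rfl⟩).2
  let N : (D → D) → ℕ := fun π =>
    (Finset.univ.filter fun q : D × D => Linked θ π q.1 q.2).card
  obtain ⟨π, hπ, hmax⟩ := Set.exists_max_image P N (Set.toFinite P) hP
  refine ⟨π, hπ.1, hπ.2.1, hπ.2.2, fun x y hxy => ?_⟩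
  by_contra hn
  obtain ⟨ρ, h1, h2, h3, h4, h5⟩ := Linked.exists_merge hθ hθ' hπ.1 hπ.2.1 hπ.2.2 hxy hn
  refine absurd (hmax ρ ⟨h1, h2, h3⟩) (not_le.2 (Finset.card_lt_card ?_))
  refine Finset.ssubset_iff_of_subset (fun q hq => ?_) |>.2 ⟨(x, y), ?_, ?_⟩
  · simp only [Finset.mem_filter, Finset.mem_univ, true_and] at hq ⊢
    exact h4 _ _ hq
  · simpa using h5
  · simpa using hn

/-- The permutation `σ` = π ∘ θ advances one edge along the trail. The class of x is the disjoint
union of its `σ`-orbit and the reversed orbit, so the orbit has even length, and the parity of the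
exponent is a well-defined colour. -/
theorem Linked.exists_alternating_on {D : Type*} [Fintype D] {θ π : D → D}
    (hθ : ∀ x, θ (θ x) = x) (hθ' : ∀ x, θ x ≠ x) (hπ : ∀ x, π (π x) = x) (hπ' : ∀ x, π x ≠ x)
    (x : D) (h4 : 4 ∣ (Finset.univ.filter fun y => Linked θ π x y).card) :
    ∃ c : D → Bool, ∀ y, Linked θ π x y → c (θ y) = c y ∧ c (π y) = !c y := by
  let σ : Equiv.Perm D := (Function.Involutive.toPerm θ hθ).trans (Function.Involutive.toPerm π hπ)
  have hσ : ∀ y, σ y = π (θ y) := fun y => rfl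
  have hσ' : ∀ y, σ⁻¹ y = θ (π y) := fun y => rfl
  have E := Linked.equivalence θ π
  -- reversal conjugates `σ` to its inverse
  have hconj : ∀ (i : ℤ) y, θ ((σ ^ i) y) = (σ ^ (-i)) (θ y) := by
    intro i
    induction i using Int.induction_on with
    | zero => simp
    | succ n ih =>
      intro y
      rw [zpow_add, zpow_one, Equiv.Perm.mul_apply, ih, neg_add, zpow_add,
        Equiv.Perm.mul_apply, zpow_neg_one, hσ, hσ']
    | pred n ih =>
      intro y
      rw [sub_eq_add_neg, zpow_add, zpow_neg_one, Equiv.Perm.mul_apply, ih, neg_add, neg_neg,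
        zpow_add, Equiv.Perm.mul_apply, neg_neg, zpow_one, hσ, hσ', hθ, hθ]
  have hpi : ∀ (i : ℤ) y, π ((σ ^ i) y) = θ ((σ ^ (i - 1)) y) := by
    intro i y
    have : (σ ^ i) y = σ ((σ ^ (i - 1)) y) := by
      rw [← Equiv.Perm.mul_apply, ← zpow_one_add]; congr 2; ring
    rw [this, hσ, hπ]
  have hpi' : ∀ (i : ℤ) y, π (θ ((σ ^ i) y)) = (σ ^ (i + 1)) y := by
    intro i y
    rw [← hσ, ← Equiv.Perm.mul_apply, ← zpow_one_add, add_comm]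
  -- If the orbit met its reversal, `θ` would act on exponents as k ↦ i + j − k. Then `θ` has a
  -- fixed point if i + j is even, and `π` has one if i + j is odd.
  have hdisj : ∀ i j : ℤ, θ ((σ ^ i) x) ≠ (σ ^ j) x := by
    intro i j h
    have hk : ∀ k : ℤ, θ ((σ ^ k) x) = (σ ^ (i + j - k)) x := by
      intro k
      have : (σ ^ k) x = (σ ^ (k - i)) ((σ ^ i) x) := by
        rw [← Equiv.Perm.mul_apply, ← zpow_add]; congr 2; ring
      rw [this, hconj, h, ← Equiv.Perm.mul_apply, ← zpow_add]; congr 2; ring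
    rcases Int.even_or_odd' (i + j) with ⟨m, hm | hm⟩
    · apply hθ' ((σ ^ m) x)
      rw [hk, hm]; congr 2; ring
    · apply hπ' ((σ ^ (m + 1)) x)
      rw [hpi, hk, hm]; congr 2; ring
  have hlink : ∀ i : ℤ, Linked θ π x ((σ ^ i) x) := by
    intro i
    induction i using Int.induction_on with
    | zero => exact E.refl x
    | succ n ih =>
      rw [add_comm, zpow_one_add, Equiv.Perm.mul_apply, hσ]
      exact E.trans ih (E.trans (Linked.left _ _ _) (Linked.right _ _ _))
    | pred n ih =>
      rw [sub_eq_neg_add, zpow_add, zpow_neg_one, Equiv.Perm.mul_apply, hσ']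
      exact E.trans ih (E.trans (Linked.right _ _ _) (Linked.left _ _ _))
  have hcover : ∀ y, Linked θ π x y → ∃ i : ℤ, y = (σ ^ i) x ∨ y = θ ((σ ^ i) x) := by
    let Q : D → Prop := fun y => ∃ i : ℤ, y = (σ ^ i) x ∨ y = θ ((σ ^ i) x)
    have hQθ : ∀ y, Q y → Q (θ y) := by
      rintro y ⟨i, rfl | rfl⟩
      exacts [⟨i, Or.inr rfl⟩, ⟨i, Or.inl (hθ _)⟩]
    have hQπ : ∀ y, Q y → Q (π y) := by
      rintro y ⟨i, rfl | rfl⟩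
      exacts [⟨i - 1, Or.inr (hpi _ _)⟩, ⟨i + 1, Or.inl (hpi' _ _)⟩]
    intro y hy
    have : (Q x ↔ Q y) := by
      refine Linked.mono_of (r := fun a b => (Q a ↔ Q b)) ⟨fun _ => Iff.rfl, Iff.symm, Iff.trans⟩
        (fun a => ⟨hQθ a, fun h => ?_⟩) (fun a => ⟨hQπ a, fun h => ?_⟩) hy
      · simpa [hθ] using hQθ _ h
      · simpa [hπ] using hQπ _ h
    exact this.1 ⟨0, Or.inl (by simp)⟩
  -- the number of edges of the closed trail is even
  let O : Finset D := Finset.univ.filter fun y => ∃ i : ℤ, (σ ^ i) x = y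
  have hO : (Finset.univ.filter fun y => Linked θ π x y) = O ∪ O.image θ := by
    ext y
    simp only [Finset.mem_filter, Finset.mem_univ, true_and, Finset.mem_union, Finset.mem_image, O]
    constructor
    · intro hy
      obtain ⟨i, rfl | rfl⟩ := hcover y hy
      exacts [Or.inl ⟨i, rfl⟩, Or.inr ⟨_, ⟨i, rfl⟩, rfl⟩]
    · rintro (⟨i, rfl⟩ | ⟨_, ⟨i, rfl⟩, rfl⟩)
      exacts [hlink i, E.trans (hlink i) (Linked.left _ _ _)]
  have hcard : 2 ∣ O.card := by
    rw [hO, Finset.card_union_of_disjoint, Finset.card_image_of_injective] at h4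
    · omega
    · exact fun a b h => by rw [← hθ a, h, hθ]
    · rw [Finset.disjoint_left]
      intro y hy hy'
      simp only [Finset.mem_filter, Finset.mem_univ, true_and, Finset.mem_image, O] at hy hy'
      obtain ⟨i, rfl⟩ := hy
      obtain ⟨_, ⟨j, rfl⟩, h⟩ := hy'
      exact hdisj _ _ h
  have hper : Function.minimalPeriod σ x = O.card := by
    have h := MulAction.minimalPeriod_eq_card (a := σ) (b := x)
    refine h.trans ?_
    rw [← Fintype.card_coe]
    refine Fintype.card_congr (Equiv.subtypeEquivRight fun y => ?_)
    simp only [O, Finset.mem_filter, Finset.mem_univ, true_and, MulAction.mem_orbit_iff]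
    constructor
    · rintro ⟨⟨_, i, rfl⟩, rfl⟩; exact ⟨i, rfl⟩
    · rintro ⟨i, rfl⟩; exact ⟨⟨_, i, rfl⟩, rfl⟩
  have heven : ∀ i j : ℤ, (σ ^ i) x = (σ ^ j) x → (Even i ↔ Even j) := by
    intro i j h
    have h0 : (σ ^ (i - j)) • x = x := by
      rw [sub_eq_neg_add, zpow_add, Equiv.Perm.smul_def, Equiv.Perm.mul_apply, h,
        ← Equiv.Perm.mul_apply, ← zpow_add]
      simp
    rw [MulAction.zpow_smul_eq_iff_minimalPeriod_dvd] at h0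
    have h1 : ((2 : ℕ) : ℤ) ∣ i - j := by
      refine (Int.natCast_dvd_natCast.2 hcard).trans ?_
      rw [← hper]
      exact h0
    have h2 : Even (i - j) := even_iff_two_dvd.2 h1
    exact Int.even_sub.1 h2
  let c : D → Bool := fun y => decide (∃ i : ℤ, Even i ∧ (y = (σ ^ i) x ∨ y = θ ((σ ^ i) x)))
  have c1 : ∀ i : ℤ, c ((σ ^ i) x) = decide (Even i) := by
    intro i
    simp only [c, decide_eq_decide]
    constructor
    · rintro ⟨j, hj, h | h⟩
      · exact (heven _ _ h).2 hj
      · exact absurd h.symm (hdisj _ _)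
    · exact fun h => ⟨i, h, Or.inl rfl⟩
  have c2 : ∀ y, c (θ y) = c y := by
    intro y
    simp only [c, decide_eq_decide]
    constructor
    · rintro ⟨j, hj, h | h⟩
      · exact ⟨j, hj, Or.inr (by rw [← h, hθ])⟩
      · exact ⟨j, hj, Or.inl (by rw [← hθ y, h, hθ])⟩
    · rintro ⟨j, hj, h | h⟩
      · exact ⟨j, hj, Or.inr (by rw [h])⟩
      · exact ⟨j, hj, Or.inl (by rw [h, hθ])⟩
  refine ⟨c, fun y hy => ⟨c2 y, ?_⟩⟩
  obtain ⟨i, rfl | rfl⟩ := hcover y hy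
  · rw [hpi, c2, c1, c1, ← decide_not, decide_eq_decide]
    exact Int.even_sub_one
  · rw [hpi', c2, c1, c1, ← decide_not, decide_eq_decide]
    exact Int.even_add_one

theorem Linked.exists_alternating {D : Type*} [Fintype D] {θ π : D → D}
    (hθ : ∀ x, θ (θ x) = x) (hθ' : ∀ x, θ x ≠ x) (hπ : ∀ x, π (π x) = x) (hπ' : ∀ x, π x ≠ x)
    (h4 : ∀ x, 4 ∣ (Finset.univ.filter fun y => Linked θ π x y).card) :
    ∃ c : D → Bool, ∀ y, c (θ y) = c y ∧ c (π y) = !c y := by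
  choose c hc using fun x => Linked.exists_alternating_on hθ hθ' hπ hπ' x (h4 x)
  let s : Setoid D := ⟨Linked θ π, Linked.equivalence θ π⟩
  let r : D → D := fun y => (Quotient.mk s y).out
  have hr : ∀ y, Linked θ π (r y) y := fun y => Quotient.exact (Quotient.out_eq (Quotient.mk s y))
  have hr' : ∀ y z, Linked θ π y z → r y = r z := fun y z h => by
    simp only [r]; rw [Quotient.sound (s := s) h]
  refine ⟨fun y => c (r y) y, fun y => ⟨?_, ?_⟩⟩
  · simp only [← hr' y _ (Linked.left _ _ _)]
    exact (hc _ y (hr y)).1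
  · simp only [← hr' y _ (Linked.right _ _ _)]
    exact (hc _ y (hr y)).2

end Darts

/-! ### Splitting a graph into two of half the degree -/

section Splitting

open scoped Classical

/-- A multigraph with edge set `E` and vertex set `V` is given by the map `p` that sends the two
darts `(e, true)` and `(e, false)` of each edge `e` to its two ends. If it is `2d`-regular and
each union of components has an even number of edges, it splits into two `d`-regular graphs. -/
theorem exists_split_of_regular {E V : Type*} [Fintype E] [Fintype V] (p : E × Bool → V) (d : ℕ)
    (hdeg : ∀ v, (Finset.univ.filter fun x => p x = v).card = 2 * d)
    (hS : ∀ S : Finset V, (∀ e, p (e, true) ∈ S ↔ p (e, false) ∈ S) → Even (d * S.card)) :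
    ∃ c : E → Bool, ∀ v b, (Finset.univ.filter fun x : E × Bool => p x = v ∧ c x.1 = b).card = d := by
  let θ : E × Bool → E × Bool := fun x => (x.1, !x.2)
  have hθ : ∀ x, θ (θ x) = x := fun x => by simp [θ]
  have hθ' : ∀ x, θ x ≠ x := fun x h => by
    have := congrArg Prod.snd h
    simp [θ] at this
  obtain ⟨π, hπ, hπ', hf, hlink⟩ := exists_linked_pairing (f := p) hθ hθ'
    (fun v => ⟨d, by rw [hdeg, two_mul]⟩)
  have Eq := Linked.equivalence θ π
  obtain ⟨c, hc⟩ := Linked.exists_alternating hθ hθ' hπ hπ' (fun x => by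
    -- A class contains every dart at each vertex it visits, hence has 2d|S| darts, a multiple of 4
    -- by `hS`.
    let X := Finset.univ.filter fun y => Linked θ π x y
    let S := X.image p
    have hX : ∀ y, y ∈ X ↔ p y ∈ S := by
      intro y
      refine ⟨fun h => Finset.mem_image_of_mem p h, fun h => ?_⟩
      obtain ⟨z, hz, h⟩ := Finset.mem_image.1 h
      simp only [X, Finset.mem_filter, Finset.mem_univ, true_and] at hz ⊢
      exact Eq.trans hz (hlink _ _ h)
    have hXθ : ∀ y, y ∈ X → θ y ∈ X := by
      intro y hy
      simp only [X, Finset.mem_filter, Finset.mem_univ, true_and] at hy ⊢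
      exact Eq.trans hy (Linked.left _ _ _)
    have h1 := hS S fun e => by
      rw [← hX, ← hX]
      exact ⟨hXθ (e, true), hXθ (e, false)⟩
    have h2 : X.card = 2 * (d * S.card) := by
      rw [Finset.card_eq_sum_card_fiberwise (f := p) (t := S)
        (fun y hy => (hX y).1 hy), Finset.sum_congr rfl (g := fun _ => 2 * d), Finset.sum_const,
        smul_eq_mul]
      · ring
      · intro v hv
        rw [← hdeg v]
        congr 1
        ext y
        simp only [Finset.mem_filter, Finset.mem_univ, true_and, and_iff_right_iff_imp]
        rintro rfl
        exact (hX y).2 hv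
    obtain ⟨m, hm⟩ := h1
    exact ⟨m, by rw [show (Finset.univ.filter fun y => Linked θ π x y).card = _ from h2, hm]; ring⟩)
  have hc' : ∀ x : E × Bool, c (x.1, true) = c x := by
    rintro ⟨e, _ | _⟩
    · exact (hc (e, false)).1
    · rfl
  -- `π` is injective, stays at the vertex and flips the colour, so both colours occur equally often
  -- there.
  have hle : ∀ v b, (Finset.univ.filter fun x : E × Bool => p x = v ∧ c x = b).card ≤
      (Finset.univ.filter fun x : E × Bool => p x = v ∧ c x = !b).card := by
    intro v b
    refine Finset.card_le_card_of_injOn π (fun x hx => ?_)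
      (fun x _ y _ h => by rw [← hπ x, h, hπ])
    simp only [Finset.coe_filter, Finset.mem_univ, true_and, Set.mem_ofPred_eq] at hx ⊢
    rw [hf, (hc x).2, hx.1, hx.2]
    simp
  refine ⟨fun e => c (e, true), fun v b => ?_⟩
  simp only [hc']
  have h1 := hle v b
  have h2 := hle v (!b)
  rw [Bool.not_not] at h2
  have h3 := Finset.card_filter_add_card_filter_not (s := Finset.univ.filter fun x => p x = v) (fun x => c x = b)
  rw [Finset.filter_filter, Finset.filter_filter, hdeg] at h3
  have h4 : (Finset.univ.filter fun x : E × Bool => p x = v ∧ ¬ c x = b) =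
      Finset.univ.filter fun x : E × Bool => p x = v ∧ c x = !b := by
    ext x
    simp only [Finset.mem_filter, Finset.mem_univ, true_and]
    cases c x <;> cases b <;> simp
  rw [h4] at h3
  omega

/-- If all degrees are at most `2d`, the multigraph splits into two graphs with degrees at most
`d`, unless there is an obstruction: a `2d`-regular union of components with an odd number of
edges. -/
theorem exists_split {E V : Type*} [Fintype E] [Fintype V] (p : E × Bool → V) (d : ℕ)
    (hdeg : ∀ v, (Finset.univ.filter fun x => p x = v).card ≤ 2 * d)
    (hS : ∀ S : Finset V, (∀ e, p (e, true) ∈ S ↔ p (e, false) ∈ S) →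
      (∀ v ∈ S, (Finset.univ.filter fun x => p x = v).card = 2 * d) → Even (d * S.card)) :
    ∃ c : E → Bool, ∀ v b, (Finset.univ.filter fun x : E × Bool => p x = v ∧ c x.1 = b).card ≤ d := by
  let deg : V → ℕ := fun v => (Finset.univ.filter fun x => p x = v).card
  -- Two copies of the graph, with the copies of v joined by 2d − deg v parallel edges: a 2d-regular
  -- graph.
  let q : ((E × Bool) ⊕ (Σ v : V, Fin (2 * d - deg v))) × Bool → V × Bool := fun x =>
    Sum.elim (fun y => (p (y.1, x.2), y.2)) (fun s => (s.1, x.2)) x.1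
  have hdeg₂ : ∀ w, (Finset.univ.filter fun x => q x = w).card = 2 * d := by
    rintro ⟨v, i⟩
    let f₁ : E × Bool → ((E × Bool) ⊕ (Σ v : V, Fin (2 * d - deg v))) × Bool := fun x => (Sum.inl (x.1, i), x.2)
    let f₂ : Fin (2 * d - deg v) → ((E × Bool) ⊕ (Σ v : V, Fin (2 * d - deg v))) × Bool := fun j => (Sum.inr ⟨v, j⟩, i)
    have hf₁ : Function.Injective f₁ := by
      rintro ⟨a, b⟩ ⟨a', b'⟩ h
      simpa [f₁] using h
    have hf₂ : Function.Injective f₂ := by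
      intro a b h
      simpa [f₂] using h
    have : (Finset.univ.filter fun x => q x = (v, i)) =
        (Finset.univ.filter fun x => p x = v).image f₁ ∪ Finset.univ.image f₂ := by
      ext ⟨x, b⟩
      simp only [Finset.mem_filter, Finset.mem_univ, true_and, Finset.mem_union, Finset.mem_image]
      constructor
      · intro h
        rcases x with ⟨e, j⟩ | ⟨u, j⟩
        · simp only [q, Sum.elim_inl, Prod.mk.injEq] at h
          obtain ⟨h, rfl⟩ := h
          exact Or.inl ⟨(e, b), h, rfl⟩
        · simp only [q, Sum.elim_inr, Prod.mk.injEq] at h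
          obtain ⟨rfl, rfl⟩ := h
          exact Or.inr ⟨j, rfl⟩
      · rintro (⟨⟨e, b'⟩, h, h'⟩ | ⟨j, h'⟩)
        · rw [← h']
          simp only [q, f₁, Sum.elim_inl, h]
        · rw [← h']
          simp only [q, f₂, Sum.elim_inr]
    rw [this, Finset.card_union_of_disjoint, Finset.card_image_of_injective _ hf₁,
      Finset.card_image_of_injective _ hf₂, Finset.card_univ, Fintype.card_fin]
    · have := hdeg v
      simp only [deg]
      omega
    · rw [Finset.disjoint_left]
      intro y h h'
      obtain ⟨a, -, rfl⟩ := Finset.mem_image.1 h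
      obtain ⟨b, -, h⟩ := Finset.mem_image.1 h'
      simp [f₁, f₂] at h
  obtain ⟨c, hc⟩ := exists_split_of_regular q d (fun w => by convert hdeg₂ w) (fun S h => by
    let T : Bool → Finset V := fun i => Finset.univ.filter fun v => (v, i) ∈ S
    have hT : ∀ i e, p (e, true) ∈ T i ↔ p (e, false) ∈ T i := by
      intro i e
      simpa [T, q] using h (Sum.inl (e, i))
    have hfull : ∀ v, deg v < 2 * d → (v ∈ T true ↔ v ∈ T false) := by
      intro v hv
      simpa [T, q] using h (Sum.inr ⟨v, ⟨0, by omega⟩⟩)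
    -- A vertex of `S` in one copy only has no joining edge, so its degree is already 2d and `hS`
    -- applies. Vertices present in both copies contribute an even amount.
    have hdiff : ∀ i, Even (d * (T i \ T (!i)).card) := by
      intro i
      refine hS _ (fun e => ?_) (fun v hv => ?_)
      · rw [Finset.mem_sdiff, Finset.mem_sdiff, hT, hT]
      · rw [Finset.mem_sdiff] at hv
        refine (hdeg v).antisymm (not_lt.1 fun h => ?_)
        have := hfull v h
        cases i <;> simp_all
    have hcard : S.card = (T true).card + (T false).card := by
      have : S = (T true).image (fun v => (v, true)) ∪ (T false).image (fun v => (v, false)) := by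
        ext ⟨v, i⟩
        cases i <;> simp [T]
      conv_lhs => rw [this]
      rw [Finset.card_union_of_disjoint, Finset.card_image_of_injective,
        Finset.card_image_of_injective]
      · exact fun a b h => (Prod.ext_iff.1 h).1
      · exact fun a b h => (Prod.ext_iff.1 h).1
      · rw [Finset.disjoint_left]
        intro y h h'
        obtain ⟨a, -, rfl⟩ := Finset.mem_image.1 h
        obtain ⟨b, -, h⟩ := Finset.mem_image.1 h'
        simp at h
    have h1 := Finset.card_sdiff_add_card_inter (T true) (T false)
    have h2 := Finset.card_sdiff_add_card_inter (T false) (T true)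
    rw [Finset.inter_comm] at h2
    obtain ⟨a, ha⟩ := hdiff true
    obtain ⟨b, hb⟩ := hdiff false
    simp only [Bool.not_true, Bool.not_false] at ha hb
    refine ⟨a + b + d * (T true ∩ T false).card, ?_⟩
    rw [hcard, ← h1, ← h2]
    linear_combination ha + hb)
  refine ⟨fun e => c (Sum.inl (e, true)), fun v b => ?_⟩
  refine le_of_le_of_eq ?_ (hc (v, true) b)
  refine Finset.card_le_card_of_injOn (fun x => (Sum.inl (x.1, true), x.2)) (fun x hx => ?_) ?_
  · simpa [q] using hx
  · rintro ⟨a, b⟩ - ⟨a', b'⟩ - h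
    simpa using h

/-- The number of darts at `v` that belong to edges in `G` of colour `i`. -/
noncomputable def dartCount {E V C : Type*} [Fintype E] (p : E × Bool → V) (G : Finset E)
    (c : E → C) (v : V) (i : C) : ℕ :=
  (Finset.univ.filter fun x : E × Bool => p x = v ∧ x.1 ∈ G ∧ c x.1 = i).card

/-- The colouring `c` of the edges in `G` has defect `d`. -/
def IsDefective {E V C : Type*} [Fintype E] (p : E × Bool → V) (d : ℕ) (G : Finset E)
    (c : E → C) : Prop :=
  ∀ v i, dartCount p G c v i ≤ d

end Splitting

/-! ### Extending a defective colouring edge by edge -/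

section Colouring

open scoped Classical

variable {E V C : Type*} {p : E × Bool → V} {d : ℕ}

/-- The number of ends of the edge `e` that are equal to `v`. -/
noncomputable def endCount (p : E × Bool → V) (e : E) (v : V) : ℕ :=
  (if p (e, true) = v then 1 else 0) + if p (e, false) = v then 1 else 0

theorem one_le_endCount (e : E) (b : Bool) : 1 ≤ endCount p e (p (e, b)) := by
  cases b <;> simp [endCount]

theorem endCount_left {e : E} {b : Bool} (hl : p (e, true) ≠ p (e, false)) :
    endCount p e (p (e, b)) = 1 := by
  cases b <;> simp [endCount, hl, hl.symm]

theorem endCount_of_ne {e : E} {b : Bool} {v : V} (h₁ : p (e, b) ≠ v) (h₂ : p (e, !b) ≠ v) :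
    endCount p e v = 0 := by
  cases b <;> simp_all [endCount]

variable [Fintype E]

theorem dartCount_eq_sum (G : Finset E) (c : E → C) (v : V) (i : C) :
    dartCount p G c v i = ∑ f ∈ G, if c f = i then endCount p f v else 0 := by
  rw [dartCount, Finset.card_filter, Fintype.sum_prod_type, ← Finset.sum_filter_add_sum_filter_not
    Finset.univ (fun f => f ∈ G)]
  rw [Finset.sum_eq_zero (s := Finset.univ.filter fun f => f ∉ G)]
  · rw [add_zero]
    have : Finset.univ.filter (fun f => f ∈ G) = G := by ext; simp
    rw [this]
    refine Finset.sum_congr rfl fun f hf => ?_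
    rw [Fintype.sum_bool]
    by_cases h : c f = i <;> simp [hf, h, endCount]
  · intro f hf
    simp only [Finset.mem_filter, Finset.mem_univ, true_and] at hf
    simp [hf]

theorem dartCount_congr {G : Finset E} {c c' : E → C} (h : ∀ f ∈ G, c f = c' f) (v : V) (i : C) :
    dartCount p G c v i = dartCount p G c' v i := by
  rw [dartCount_eq_sum, dartCount_eq_sum]
  exact Finset.sum_congr rfl fun f hf => by rw [h f hf]

theorem dartCount_insert {G : Finset E} {e : E} (he : e ∉ G) (c : E → C) (v : V) (i : C) :
    dartCount p (insert e G) c v i =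
      dartCount p G c v i + if c e = i then endCount p e v else 0 := by
  rw [dartCount_eq_sum, dartCount_eq_sum, Finset.sum_insert he, add_comm]

theorem dartCount_insert_update {G : Finset E} {e : E} (he : e ∉ G) (c : E → C) (α : C) (v : V)
    (i : C) : dartCount p (insert e G) (Function.update c e α) v i =
      dartCount p G c v i + if α = i then endCount p e v else 0 := by
  rw [dartCount_insert he, Function.update_self]
  congr 1
  refine dartCount_congr (fun f hf => ?_) v i
  have hfe : f ≠ e := fun h => he (h ▸ hf)
  exact Function.update_of_ne hfe _ _

theorem sum_dartCount [Fintype C] (G : Finset E) (c : E → C) (v : V) :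
    ∑ i, dartCount p G c v i = ∑ f ∈ G, endCount p f v := by
  simp only [dartCount_eq_sum]
  rw [Finset.sum_comm]
  exact Finset.sum_congr rfl fun f _ => by simp

theorem sum_endCount (v : V) :
    ∑ f, endCount p f v = (Finset.univ.filter fun x => p x = v).card := by
  rw [Finset.card_filter, Fintype.sum_prod_type]
  exact Finset.sum_congr rfl fun f _ => by rw [Fintype.sum_bool, endCount]

theorem sum_dartCount_lt [Fintype C] {G : Finset E} {e : E} (he : e ∉ G) (c : E → C) (b : Bool) :
    ∑ i, dartCount p G c (p (e, b)) i < (Finset.univ.filter fun x => p x = p (e, b)).card := by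
  rw [sum_dartCount, ← sum_endCount]
  have h := Finset.sum_le_sum_of_subset (f := fun f => endCount p f (p (e, b)))
    (Finset.subset_univ (insert e G))
  rw [Finset.sum_insert he] at h
  have := one_le_endCount (p := p) e b
  omega

/-- Handshake: an edge of colour i has both ends in `S` or neither. -/
theorem even_sum_dartCount {G : Finset E} {c : E → C} {i : C} {S : Finset V}
    (hS : ∀ f ∈ G, c f = i → (p (f, true) ∈ S ↔ p (f, false) ∈ S)) :
    Even (∑ v ∈ S, dartCount p G c v i) := by
  simp only [dartCount_eq_sum]
  rw [Finset.sum_comm]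
  refine Finset.even_sum _ fun f hf => ?_
  by_cases h : c f = i
  · simp only [h, if_true, endCount, Finset.sum_add_distrib, Finset.sum_ite_eq]
    by_cases h' : p (f, false) ∈ S
    · simp [(hS f hf h).2 h', h']
    · simp [mt (hS f hf h).1 h', h']
  · simp [h]

theorem card_filter_subtype_prod (P : E → Prop) [Fintype {f // P f}] (Q : E × Bool → Prop) :
    (Finset.univ.filter fun x : {f // P f} × Bool => Q (x.1.1, x.2)).card =
      (Finset.univ.filter fun x : E × Bool => P x.1 ∧ Q x).card := by
  rw [← Finset.card_image_of_injective (f := fun x : {f // P f} × Bool => (x.1.1, x.2))]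
  · congr 1
    ext ⟨f, b⟩
    simp only [Finset.mem_image, Finset.mem_filter, Finset.mem_univ, true_and]
    constructor
    · rintro ⟨⟨⟨g, hg⟩, b'⟩, h, h'⟩
      simp only [Prod.mk.injEq] at h'
      obtain ⟨rfl, rfl⟩ := h'
      exact ⟨hg, h⟩
    · exact fun h => ⟨(⟨f, h.1⟩, b), h.2, rfl⟩
  · rintro ⟨⟨a, _⟩, b⟩ ⟨⟨a', _⟩, b'⟩ h
    simpa using h

/-- If the partial colouring `c` cannot be extended to `e`, even after changing colours, then two
colours that have room at both ends of `e` form, together with `e`, an obstruction to splitting. -/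
theorem IsDefective.exists_obstruction [Fintype V] {F : Finset E} {e : E} (he : e ∉ F)
    {c : E → C} (hc : IsDefective p d F c)
    (hn : ¬ ∃ c' : E → C, IsDefective p d (insert e F) c') (hl : p (e, true) ≠ p (e, false))
    {α β : C} (hαβ : α ≠ β)
    (hx : ∀ b, dartCount p F c (p (e, b)) α + dartCount p F c (p (e, b)) β < 2 * d) :
    Odd d ∧ ∃ S : Finset V, (∀ b, p (e, b) ∈ S) ∧
      (∀ f ∈ F, c f = α ∨ c f = β → (p (f, true) ∈ S ↔ p (f, false) ∈ S)) ∧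
      ∀ v ∈ S, dartCount p F c v α + dartCount p F c v β + endCount p e v = 2 * d := by
  let c₀ := Function.update c e α
  let G := insert e F
  have hc₀ : ∀ f ∈ F, c₀ f = c f :=
    fun f hf => Function.update_of_ne (fun h => he (by rwa [← h])) _ _
  have hc₀e : c₀ e = α := Function.update_self _ _ _
  let P : E → Prop := fun f => f ∈ G ∧ (c₀ f = α ∨ c₀ f = β)
  let q : {f // P f} × Bool → V := fun x => p (x.1.1, x.2)
  have hdeg : ∀ v, (Finset.univ.filter fun x => q x = v).card =
      dartCount p F c v α + dartCount p F c v β + endCount p e v := by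
    intro v
    have h1 := dartCount_insert_update (p := p) he c α v α
    have h2 := dartCount_insert_update (p := p) he c α v β
    rw [if_pos rfl] at h1
    rw [if_neg hαβ, add_zero] at h2
    rw [add_right_comm, ← h1, ← h2]
    refine (card_filter_subtype_prod P (fun x => p x = v)).trans ?_
    rw [dartCount, dartCount, ← Finset.card_union_of_disjoint, ← Finset.filter_or]
    · congr 1
      ext x
      simp only [Finset.mem_filter, Finset.mem_univ, true_and, P, G, c₀]
      tauto
    · rw [Finset.disjoint_left]
      intro x h h'
      simp only [Finset.mem_filter] at h h'
      exact hαβ (h.2.2.2.symm.trans h'.2.2.2)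
  have hle : ∀ v, (Finset.univ.filter fun x => q x = v).card ≤ 2 * d := by
    intro v
    rw [hdeg]
    have h1 := hx true
    have h2 := hx false
    by_cases h : p (e, true) = v
    · have h' : p (e, false) ≠ v := fun h' => hl (h.trans h'.symm)
      rw [h] at h1
      simp only [endCount, h, h', if_true, if_false]
      omega
    · by_cases h' : p (e, false) = v
      · rw [h'] at h2
        simp only [endCount, h, h', if_true, if_false]
        omega
      · have := hc v α
        have := hc v β
        simp only [endCount, h, h', if_false]
        omega
  by_contra hcon
  refine hn ?_
  obtain ⟨s, hs⟩ := exists_split q d hle (fun S hS hfull => by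
    by_contra hodd
    have hcl : ∀ f ∈ F, c f = α ∨ c f = β → (p (f, true) ∈ S ↔ p (f, false) ∈ S) :=
      fun f hf h => hS ⟨f, Finset.mem_insert_of_mem hf, by rwa [hc₀ f hf]⟩
    have hcle := hS ⟨e, Finset.mem_insert_self _ _, Or.inl hc₀e⟩
    simp only [q] at hcle
    by_cases hxS : p (e, true) ∈ S
    · refine hcon ⟨?_, S, ?_, hcl, fun v hv => by rw [← hdeg, hfull v hv]⟩
      · exact Nat.not_even_iff_odd.1 fun h => hodd (h.mul_right _)
      · rintro (_ | _)
        exacts [hcle.1 hxS, hxS]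
    -- If e avoids `S`, each vertex of `S` has exactly d darts of colour α, and no α-edge leaves
    -- `S`; so d|S| is even after all.
    · have hyS := mt hcle.2 hxS
      apply hodd
      have h1 := even_sum_dartCount (p := p) (i := α) (S := S) fun f hf h => hcl f hf (Or.inl h)
      rw [Finset.sum_congr rfl (g := fun _ => d), Finset.sum_const, smul_eq_mul, mul_comm] at h1
      · exact h1
      · intro v hv
        have h2 := (hdeg v).symm.trans (hfull v hv)
        have h3 : p (e, true) ≠ v := fun h => hxS (h ▸ hv)
        have h4 : p (e, false) ≠ v := fun h => hyS (h ▸ hv)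
        simp only [endCount, h3, h4, if_false] at h2
        have := hc v α
        have := hc v β
        omega)
  let c' : E → C := fun f => if h : P f then (if s ⟨f, h⟩ then α else β) else c₀ f
  have hs' : ∀ v b i, (∀ x : E × Bool, p x = v ∧ x.1 ∈ G ∧ c' x.1 = i →
      ∃ h : P x.1, s ⟨x.1, h⟩ = b) → dartCount p G c' v i ≤ d := by
    intro v b i h
    refine le_trans ?_ (hs v b)
    have := card_filter_subtype_prod P (fun x => p x = v ∧ ∃ h : P x.1, s ⟨x.1, h⟩ = b)
    have h' : (Finset.univ.filter fun x : {f // P f} × Bool => q x = v ∧ s x.1 = b) =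
        (Finset.univ.filter fun x : {f // P f} × Bool =>
          p (x.1.1, x.2) = v ∧ ∃ h : P x.1.1, s ⟨x.1.1, h⟩ = b) := by
      ext x
      simp only [Finset.mem_filter, Finset.mem_univ, true_and, q]
      exact and_congr_right fun _ => ⟨fun h => ⟨x.1.2, h⟩, fun ⟨_, h⟩ => h⟩
    refine le_of_le_of_eq ?_ (this.symm.trans (by rw [h']; congr!))
    refine Finset.card_le_card fun x hx => ?_
    simp only [Finset.mem_filter, Finset.mem_univ, true_and] at hx ⊢
    obtain ⟨h1, h2⟩ := h x hx
    exact ⟨h1, hx.1, h1, h2⟩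
  refine ⟨c', fun v i => ?_⟩
  by_cases hα : i = α
  · refine hs' v true i fun x ⟨_, h2, h3⟩ => ?_
    by_cases h : P x.1
    · refine ⟨h, ?_⟩
      simp only [c', h, dif_pos] at h3
      by_contra h4
      rw [if_neg h4] at h3
      exact hαβ (hα ▸ h3.symm)
    · simp only [c', h, dif_neg, not_false_iff] at h3
      exact absurd ⟨h2, Or.inl (h3.trans hα)⟩ h
  by_cases hβ : i = β
  · refine hs' v false i fun x ⟨_, h2, h3⟩ => ?_
    by_cases h : P x.1
    · refine ⟨h, ?_⟩
      simp only [c', h, dif_pos] at h3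
      by_contra h4
      rw [if_pos (by simpa using h4)] at h3
      exact hα h3.symm
    · simp only [c', h, dif_neg, not_false_iff] at h3
      exact absurd ⟨h2, Or.inr (h3.trans hβ)⟩ h
  · refine (Finset.card_le_card fun x hx => ?_).trans (hc v i)
    simp only [Finset.mem_filter, Finset.mem_univ, true_and] at hx ⊢
    obtain ⟨h1, h2, h3⟩ := hx
    have h : ¬ P x.1 := by
      intro h
      simp only [c', h, dif_pos] at h3
      split_ifs at h3
      exacts [hα h3.symm, hβ h3.symm]
    simp only [c', h, dif_neg, not_false_iff] at h3
    have hxe : x.1 ≠ e := fun h => hα (by rw [← h3, h, hc₀e])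
    have hxF : x.1 ∈ F := Finset.mem_of_mem_insert_of_ne h2 hxe
    exact ⟨h1, hxF, by rw [← hc₀ _ hxF, h3]⟩

/-- A colour with room at one end of an uncolourable edge and a colour with room at the other end
are distinct, and each of them has room for one edge only. -/
theorem IsDefective.exists_closed [Fintype V] {F : Finset E} {e : E} (he : e ∉ F)
    {c : E → C} (hc : IsDefective p d F c)
    (hn : ¬ ∃ c' : E → C, IsDefective p d (insert e F) c') (hl : p (e, true) ≠ p (e, false))
    {b : Bool} {α β : C} (hα : dartCount p F c (p (e, b)) α < d)
    (hβ : dartCount p F c (p (e, !b)) β < d) :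
    α ≠ β ∧ Odd d ∧ dartCount p F c (p (e, b)) α + 1 = d ∧ dartCount p F c (p (e, !b)) β + 1 = d ∧
      dartCount p F c (p (e, b)) β = d ∧ dartCount p F c (p (e, !b)) α = d ∧
      ∃ S : Finset V, p (e, b) ∈ S ∧ p (e, !b) ∈ S ∧
      (∀ f ∈ F, c f = α ∨ c f = β → (p (f, true) ∈ S ↔ p (f, false) ∈ S)) ∧
      ∀ v ∈ S, v ≠ p (e, b) → v ≠ p (e, !b) → dartCount p F c v α = d ∧ dartCount p F c v β = d := by
  have hαβ : α ≠ β := by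
    rintro rfl
    refine hn ⟨Function.update c e α, fun v i => ?_⟩
    rw [dartCount_insert_update he]
    have := hc v i
    split_ifs with h
    · subst h
      by_cases h1 : p (e, b) = v
      · rw [← h1, endCount_left hl]; omega
      by_cases h2 : p (e, !b) = v
      · rw [← h2, endCount_left hl]; omega
      rw [endCount_of_ne h1 h2]; omega
    · omega
  have h1 := hc (p (e, b)) β
  have h2 := hc (p (e, !b)) α
  obtain ⟨hodd, S, hS, hcl, hfull⟩ := hc.exists_obstruction he hn hl hαβ (fun b' => by
    by_cases h : b' = b
    · subst h; omega
    · have : b' = !b := by cases b <;> cases b' <;> simp_all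
      subst this; omega)
  have h3 := hfull _ (hS b)
  have h4 := hfull _ (hS !b)
  rw [endCount_left hl] at h3 h4
  refine ⟨hαβ, hodd, by omega, by omega, by omega, by omega, S, hS _, hS _, hcl,
    fun v hv n1 n2 => ?_⟩
  have h5 := hfull v hv
  rw [endCount_of_ne n1.symm n2.symm] at h5
  have := hc v α
  have := hc v β
  omega

theorem exists_dartCount_lt {k : ℕ} {F : Finset E} {e : E} (he : e ∉ F) (c : E → Fin k) (b : Bool)
    (h : (Finset.univ.filter fun x => p x = p (e, b)).card ≤ k * d) :
    ∃ i, dartCount p F c (p (e, b)) i < d := by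
  by_contra! hcon
  have h1 := sum_dartCount_lt (p := p) he c b
  have h2 := Finset.sum_le_sum fun i (_ : i ∈ Finset.univ) => hcon i
  simp only [Finset.sum_const, Finset.card_univ, Fintype.card_fin, smul_eq_mul] at h2
  omega

theorem exists_isDefective_of_extend {k : ℕ} (hk : ∀ v, (Finset.univ.filter fun x => p x = v).card ≤ k * d)
    (h : ∀ (F : Finset E) (e : E), e ∉ F → ∀ c : E → Fin k, IsDefective p d F c →
      ∃ c' : E → Fin k, IsDefective p d (insert e F) c') :
    ∃ c : E → Fin k, IsDefective p d Finset.univ c := by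
  have h0 : ∃ c : E → Fin k, IsDefective p d ∅ c := by
    -- With no colours available, the degree bound leaves no edges to colour.
    have hne : Nonempty (E → Fin k) := by
      rcases isEmpty_or_nonempty E with hE | ⟨⟨e⟩⟩
      · exact ⟨fun e => hE.elim e⟩
      · have h1 := hk (p (e, true))
        have h2 : 0 < (Finset.univ.filter fun x => p x = p (e, true)).card :=
          Finset.card_pos.2 ⟨(e, true), by simp⟩
        have : 0 < k := Nat.pos_of_ne_zero fun h => by subst h; omega
        exact ⟨fun _ => ⟨0, this⟩⟩
    obtain ⟨c⟩ := hne
    exact ⟨c, fun v i => by simp [dartCount_eq_sum]⟩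
  have : ∀ F : Finset E, ∃ c : E → Fin k, IsDefective p d F c := by
    intro F
    induction F using Finset.induction_on with
    | empty => exact h0
    | insert e F he ih =>
      obtain ⟨c, hc⟩ := ih
      exact h F e he c hc
  exact this _

theorem exists_isDefective_of_even [Fintype V] (hd : Even d) (hl : ∀ e, p (e, true) ≠ p (e, false))
    {k : ℕ} (hk : ∀ v, (Finset.univ.filter fun x => p x = v).card ≤ k * d) :
    ∃ c : E → Fin k, IsDefective p d Finset.univ c := by
  refine exists_isDefective_of_extend hk fun F e he c hc => ?_
  by_contra hn
  obtain ⟨α, hα⟩ := exists_dartCount_lt he c true (hk _)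
  obtain ⟨β, hβ⟩ := exists_dartCount_lt he c false (hk _)
  have := hc.exists_closed he hn (hl e) (b := true) hα hβ
  exact Nat.not_even_iff_odd.2 this.2.1 hd

/-- The colours that have room for a further edge at `v`. -/
noncomputable def roomy [Fintype C] (p : E × Bool → V) (d : ℕ) (F : Finset E) (c : E → C) (v : V) :
    Finset C :=
  Finset.univ.filter fun i => dartCount p F c v i < d

theorem mem_roomy [Fintype C] {F : Finset E} {c : E → C} {v : V} {i : C} :
    i ∈ roomy p d F c v ↔ dartCount p F c v i < d := by
  simp [roomy]

/-- With unit room, the number of roomy colours is kd minus the coloured degree, and the uncoloured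
e makes the latter smaller than the degree. -/
theorem lt_card_roomy_add [Fintype C] {F : Finset E} {e : E} (he : e ∉ F) {c : E → C}
    (hc : IsDefective p d F c) {b : Bool} (h : ∀ i, dartCount p F c (p (e, b)) i < d →
      dartCount p F c (p (e, b)) i + 1 = d) :
    Fintype.card C * d < (roomy p d F c (p (e, b))).card +
      (Finset.univ.filter fun x => p x = p (e, b)).card := by
  have h1 := sum_dartCount_lt (p := p) he c b
  have h2 : ∑ i, dartCount p F c (p (e, b)) i + (roomy p d F c (p (e, b))).card =
      Fintype.card C * d := by
    rw [roomy, Finset.card_filter, ← Finset.sum_add_distrib,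
      Finset.sum_congr rfl (g := fun _ => d)]
    · simp
    · intro i _
      have := hc (p (e, b)) i
      have := h i
      split_ifs <;> omega
  omega

/-- With k colours, `hk` is k ≥ (3Δ − 1)/(3d − 1) cleared of denominators. The contradiction comes
from counting roomy colours at x, y and z on the path formed by e and an α-edge at y. -/
theorem IsDefective.exists_extend [Fintype V] [Fintype C] {Δ : ℕ}
    (hl : ∀ e, p (e, true) ≠ p (e, false))
    (hΔ : ∀ v, (Finset.univ.filter fun x => p x = v).card ≤ Δ)
    (hk : 3 * Δ + Fintype.card C ≤ 3 * (Fintype.card C * d) + 1) (hC : 1 ≤ Fintype.card C)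
    {F : Finset E} {e : E} (he : e ∉ F) {c : E → C} (hc : IsDefective p d F c) :
    ∃ c' : E → C, IsDefective p d (insert e F) c' := by
  by_contra hn
  have hroom : ∀ b, ∃ i, dartCount p F c (p (e, b)) i < d := by
    intro b
    by_contra! hcon
    have h1 := sum_dartCount_lt (p := p) he c b
    have h2 := Finset.sum_le_sum fun i (_ : i ∈ Finset.univ) => hcon i
    simp only [Finset.sum_const, Finset.card_univ, smul_eq_mul] at h2
    have := hΔ (p (e, b))
    omega
  obtain ⟨α, hα⟩ := hroom true
  obtain ⟨β, hβ⟩ := hroom false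
  set x := p (e, true) with hx
  set y := p (e, false) with hy
  have hxy : x ≠ y := hl e
  have H : ∀ {i j}, dartCount p F c x i < d → dartCount p F c y j < d → _ :=
    fun hi hj => hc.exists_closed he hn (hl e) (b := true) hi hj
  simp only [Bool.not_true, ← hx, ← hy] at H
  obtain ⟨hαβ, -, hxα, hyβ, hxβ, hyα, -⟩ := H hα hβ
  -- There are d edges of colour α at y but only d − 1 at x, so not all of them join y to x.
  obtain ⟨f, b, hfF, hfα, hfy, hfx⟩ : ∃ f b, f ∈ F ∧ c f = α ∧ p (f, b) = y ∧ p (f, !b) ≠ x := by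
    by_contra! hcon
    have : dartCount p F c y α ≤ dartCount p F c x α := by
      refine Finset.card_le_card_of_injOn (fun u => (u.1, !u.2)) (fun u hu => ?_) ?_
      · simp only [Finset.coe_filter, Finset.mem_univ, true_and, Set.mem_ofPred_eq] at hu ⊢
        exact ⟨hcon _ _ hu.2.1 hu.2.2 hu.1, hu.2⟩
      · rintro ⟨u, a⟩ - ⟨u', a'⟩ - h
        simpa using h
    omega
  set z := p (f, !b) with hz
  have hzy : z ≠ y := by
    rw [← hfy, hz]
    cases b
    exacts [hl f, (hl f).symm]
  have hef : e ≠ f := fun h => he (h ▸ hfF)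
  -- The colour α moves from f to e; f is now the uncoloured edge, and the counts at y do not
  -- change.
  let F' := insert e (F.erase f)
  let c' := Function.update c e α
  have hfF' : f ∉ F' := by simp [F', hef.symm]
  have hins : insert f F' = insert e F := by
    rw [Finset.insert_comm, Finset.insert_erase hfF]
  have hc'f : c' f = α := by rw [← hfα]; exact Function.update_of_ne hef.symm _ _
  have hcount : ∀ v i, dartCount p F' c' v i + (if α = i then endCount p f v else 0) =
      dartCount p F c v i + if α = i then endCount p e v else 0 := by
    intro v i
    rw [← dartCount_insert_update he, ← hins, dartCount_insert hfF' (Function.update c e α),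
      show Function.update c e α f = α from hc'f]
  have hne : ∀ v i, α ≠ i → dartCount p F' c' v i = dartCount p F c v i := by
    intro v i h
    simpa [h] using hcount v i
  have hy' : ∀ i, dartCount p F' c' y i = dartCount p F c y i := by
    intro i
    have h1 : endCount p f y = 1 := by rw [← hfy]; exact endCount_left (hl f)
    have h2 : endCount p e y = 1 := endCount_left (hl e)
    have := hcount y i
    rw [h1, h2] at this
    omega
  have hc' : IsDefective p d F' c' := by
    intro v i
    by_cases h : α = i
    · subst h
      have h0 := hcount v α
      rw [if_pos rfl, if_pos rfl] at h0
      have := hc v α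
      by_cases h1 : x = v
      · subst h1
        have h2 : endCount p e x = 1 := endCount_left (hl e)
        omega
      by_cases h2 : y = v
      · subst h2
        rw [hy']; exact this
      rw [endCount_of_ne (b := true) (e := e) h1 h2] at h0
      omega
    · rw [hne v i h]; exact hc v i
  have H' : ∀ {i j}, dartCount p F' c' z i < d → dartCount p F' c' y j < d → _ :=
    fun hi hj => hc'.exists_closed hfF' (by rwa [hins]) (hl f) (b := !b) hi
      (by rw [Bool.not_not, hfy]; exact hj)
  simp only [Bool.not_not, ← hz, hfy, hy'] at H'
  -- For γ ≠ α, compare the γβ-obstructions `S` around e and `T` around f. Room for γ keeps z out of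
  -- `S` and x out of `T`, and neither e nor f has colour γ or β, before or after the move, where
  -- this matters for closing S ∩ T.
  have key : ∀ γ, dartCount p F c x γ < d → dartCount p F' c' z γ < d → γ = α := by
    intro γ h1 h2
    by_contra hγ
    obtain ⟨-, -, -, -, -, hyγ, S, -, hyS, hcl, hfull⟩ := H h1 hβ
    obtain ⟨-, -, -, -, -, -, T, -, hyT, hcl', hfull'⟩ := H' h2 hβ
    have hzS : z ∉ S := by
      intro h
      have := (hfull z h hfx hzy).1
      rw [hne _ _ (Ne.symm hγ)] at h2
      omega
    have hxT : x ∉ T := by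
      intro h
      have := (hfull' x h (Ne.symm hfx) hxy).1
      rw [hne _ _ (Ne.symm hγ)] at this
      omega
    have hcl₂ : ∀ g ∈ F, c g = γ ∨ c g = β → (p (g, true) ∈ S ∩ T ↔ p (g, false) ∈ S ∩ T) := by
      intro g hg h
      have hgf : g ≠ f := by
        rintro rfl
        rcases h with h | h
        · exact hγ (h.symm.trans hfα)
        · exact hαβ (hfα.symm.trans h)
      have hge : g ≠ e := fun h => he (h ▸ hg)
      rw [Finset.mem_inter, Finset.mem_inter, hcl g hg h, hcl' g]
      · exact Finset.mem_insert_of_mem (Finset.mem_erase.2 ⟨hgf, hg⟩)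
      · rwa [show c' g = c g from Function.update_of_ne hge _ _]
    -- Every vertex of S ∩ T is full in γ and β, except that y lacks one β-edge. The two dart sums
    -- differ by one, yet both are even.
    have e1 := even_sum_dartCount (p := p) (i := γ) fun g hg h => hcl₂ g hg (Or.inl h)
    have e2 := even_sum_dartCount (p := p) (i := β) fun g hg h => hcl₂ g hg (Or.inr h)
    have hyST : y ∈ S ∩ T := Finset.mem_inter.2 ⟨hyS, hyT⟩
    have hv : ∀ v ∈ (S ∩ T).erase y, dartCount p F c v γ = d ∧ dartCount p F c v β = d := by
      intro v hv
      obtain ⟨hvy, hv⟩ := Finset.mem_erase.1 hv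
      obtain ⟨hvS, hvT⟩ := Finset.mem_inter.1 hv
      exact hfull v hvS (fun h => hxT (h ▸ hvT)) hvy
    rw [← Finset.add_sum_erase _ _ hyST, Finset.sum_congr rfl (fun v h => (hv v h).1), hyγ] at e1
    rw [← Finset.add_sum_erase _ _ hyST, Finset.sum_congr rfl (fun v h => (hv v h).2)] at e2
    obtain ⟨m, hm⟩ := e1
    obtain ⟨n, hn⟩ := e2
    omega
  -- Each roomy set has at least kd − Δ + 1 colours. The one at y is disjoint from the others, which
  -- share at most α, so 3(kd − Δ + 1) ≤ k + 1, against `hk`.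
  have c1 := lt_card_roomy_add he hc (b := true) fun i hi => (H hi hβ).2.2.1
  have c2 := lt_card_roomy_add he hc (b := false) fun i hi => (H hα hi).2.2.2.1
  have c3 := lt_card_roomy_add hfF' hc' (b := !b) fun i hi => (H' hi hβ).2.2.1
  simp only [← hx, ← hy, ← hz] at c1 c2 c3
  have d1 : Disjoint (roomy p d F c x ∪ roomy p d F' c' z) (roomy p d F c y) := by
    rw [Finset.disjoint_left]
    intro i h h'
    rw [mem_roomy] at h'
    rcases Finset.mem_union.1 h with h | h
    · exact (H (mem_roomy.1 h) h').1 rfl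
    · exact (H' (mem_roomy.1 h) h').1 rfl
  have d2 : (roomy p d F c x ∩ roomy p d F' c' z).card ≤ 1 := by
    refine (Finset.card_le_card (t := {α}) fun i hi => ?_).trans_eq (Finset.card_singleton α)
    obtain ⟨h, h'⟩ := Finset.mem_inter.1 hi
    exact Finset.mem_singleton.2 (key i (mem_roomy.1 h) (mem_roomy.1 h'))
  have d3 := Finset.card_union_of_disjoint d1
  have d4 := Finset.card_union_add_card_inter (roomy p d F c x) (roomy p d F' c' z)
  have d5 := Finset.card_le_univ (roomy p d F c x ∪ roomy p d F' c' z ∪ roomy p d F c y)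
  have e1 := hΔ x
  have e2 := hΔ y
  have e3 := hΔ z
  omega

theorem exists_isDefective [Fintype V] {Δ k : ℕ} (hl : ∀ e, p (e, true) ≠ p (e, false))
    (hΔ : ∀ v, (Finset.univ.filter fun x => p x = v).card ≤ Δ)
    (hk : 3 * Δ + k ≤ 3 * (k * d) + 1) (hk' : 1 ≤ k) :
    ∃ c : E → Fin k, IsDefective p d Finset.univ c := by
  refine exists_isDefective_of_extend (fun v => (hΔ v).trans (by omega)) fun F e he c hc => ?_
  exact hc.exists_extend hl hΔ (by simpa using hk) (by simpa using hk') he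

end Colouring

/-! ### From dart maps back to multigraphs; Shannon multigraphs -/

namespace Graph

section Transfer

open scoped Classical

variable {α β : Type*} {G : Graph α β}

theorem exists_ends (G : Graph α β) [G.Loopless] :
    ∃ p : G.edgeSet × Bool → G.vertexSet, (∀ e, p (e, true) ≠ p (e, false)) ∧
      ∀ (e : G.edgeSet) v, G.Inc e v ↔ ∃ b, (p (e, b) : α) = v := by
  choose x y h using fun e : G.edgeSet => G.exists_isLink_of_mem_edgeSet e.2
  refine ⟨fun u => bif u.2 then ⟨x u.1, (h u.1).left_mem⟩ else ⟨y u.1, (h u.1).right_mem⟩,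
    fun e he => (h e).ne (congrArg Subtype.val he), fun e v => ⟨fun hv => ?_, ?_⟩⟩
  · rcases hv.eq_or_eq_of_isLink (h e) with rfl | rfl
    exacts [⟨true, rfl⟩, ⟨false, rfl⟩]
  · rintro ⟨_ | _, rfl⟩
    exacts [(h e).inc_right, (h e).inc_left]

theorem ncard_inc_eq [Fintype G.edgeSet] {p : G.edgeSet × Bool → G.vertexSet}
    (hp : ∀ e, p (e, true) ≠ p (e, false)) (hp' : ∀ (e : G.edgeSet) v, G.Inc e v ↔ ∃ b, (p (e, b) : α) = v)
    (Q : G.edgeSet → Prop) (v : G.vertexSet) :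
    {e : G.edgeSet | G.Inc e v ∧ Q e}.ncard =
      (Finset.univ.filter fun x : G.edgeSet × Bool => p x = v ∧ Q x.1).card := by
  rw [← Finset.card_image_of_injOn (f := Prod.fst), ← Set.ncard_coe_finset]
  · congr 1
    ext e
    simp only [Set.mem_ofPred_eq, Finset.coe_image, Set.mem_image, Finset.coe_filter,
      Finset.mem_univ, true_and, hp']
    constructor
    · rintro ⟨⟨b, hb⟩, h⟩
      exact ⟨(e, b), ⟨Subtype.ext hb, h⟩, rfl⟩
    · rintro ⟨⟨e, b⟩, ⟨h, h'⟩, rfl⟩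
      exact ⟨⟨b, congrArg Subtype.val h⟩, h'⟩
  · rintro ⟨e, b⟩ h ⟨e', b'⟩ h' (rfl : e = e')
    simp only [Finset.coe_filter, Finset.mem_univ, true_and, Set.mem_ofPred_eq] at h h'
    have h1 := h.1.trans h'.1.symm
    cases b <;> cases b'
    exacts [rfl, absurd h1.symm (hp e), absurd h1 (hp e), rfl]

theorem degree_eq_ncard (v : α) : G.degree v = {e : G.edgeSet | G.Inc e v}.ncard := by
  rw [degree, ← Set.ncard_image_of_injective _ Subtype.val_injective]
  congr 1
  ext e
  simp only [Set.mem_ofPred_eq, Set.mem_image, Subtype.exists, exists_and_left, exists_prop,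
    exists_eq_right_right]
  exact ⟨fun h => ⟨h, h.edge_mem⟩, fun h => h.1⟩

theorem degree_eq_card [Fintype G.edgeSet] {p : G.edgeSet × Bool → G.vertexSet}
    (hp : ∀ e, p (e, true) ≠ p (e, false)) (hp' : ∀ (e : G.edgeSet) v, G.Inc e v ↔ ∃ b, (p (e, b) : α) = v)
    (v : G.vertexSet) : G.degree v = (Finset.univ.filter fun x => p x = v).card := by
  have := ncard_inc_eq hp hp' (fun _ => True) v
  simpa only [and_true, ← degree_eq_ncard] using this

theorem defectiveEdgeColourable_of_isDefective [Fintype G.edgeSet] {d k : ℕ}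
    {p : G.edgeSet × Bool → G.vertexSet}
    (hp : ∀ e, p (e, true) ≠ p (e, false)) (hp' : ∀ (e : G.edgeSet) v, G.Inc e v ↔ ∃ b, (p (e, b) : α) = v)
    (h : ∃ c : G.edgeSet → Fin k, IsDefective p d Finset.univ c) :
    G.DefectiveEdgeColourable k d := by
  obtain ⟨c, hc⟩ := h
  refine ⟨c, fun v hv i => ?_⟩
  rw [ncard_inc_eq hp hp' (fun e => c e = i) ⟨v, hv⟩]
  refine le_trans (le_of_eq ?_) (hc ⟨v, hv⟩ i)
  simp only [dartCount, Finset.mem_univ, true_and]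
  congr!

theorem HasMaxDegree.degree_le {Δ : ℕ} (h : G.HasMaxDegree Δ) {v : α} (hv : v ∈ G.vertexSet) :
    G.degree v ≤ Δ :=
  h.2 (Set.mem_image_of_mem _ hv)

theorem defectiveEdgeColourable_of_even [G.Loopless] (hV : G.vertexSet.Finite)
    (hE : G.edgeSet.Finite) {d k Δ : ℕ} (hd : Even d) (hΔ : G.HasMaxDegree Δ) (hk : Δ ≤ k * d) :
    G.DefectiveEdgeColourable k d := by
  have := hV.fintype
  have := hE.fintype
  obtain ⟨p, hp, hp'⟩ := G.exists_ends
  refine defectiveEdgeColourable_of_isDefective hp hp' (exists_isDefective_of_even hd hp ?_)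
  intro v
  refine le_trans (le_of_eq ?_) ((hΔ.degree_le v.2).trans hk)
  rw [degree_eq_card hp hp']
  congr!

theorem defectiveEdgeColourable [G.Loopless] (hV : G.vertexSet.Finite)
    (hE : G.edgeSet.Finite) {d k Δ : ℕ} (hΔ : G.HasMaxDegree Δ) (hk : 3 * Δ + k ≤ 3 * (k * d) + 1)
    (hk' : 1 ≤ k) : G.DefectiveEdgeColourable k d := by
  have := hV.fintype
  have := hE.fintype
  obtain ⟨p, hp, hp'⟩ := G.exists_ends
  refine defectiveEdgeColourable_of_isDefective hp hp' (exists_isDefective hp ?_ hk hk')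
  intro v
  refine le_trans (le_of_eq ?_) (hΔ.degree_le v.2)
  rw [degree_eq_card hp hp']
  congr!

theorem DefectiveEdgeColourable.degree_le (hE : G.edgeSet.Finite) {k d : ℕ}
    (h : G.DefectiveEdgeColourable k d) {v : α} (hv : v ∈ G.vertexSet) : G.degree v ≤ k * d := by
  have := hE.fintype
  obtain ⟨c, hc⟩ := h
  rw [degree_eq_ncard, Set.ncard_eq_toFinset_card',
    Finset.card_eq_sum_card_fiberwise (f := c) (t := Finset.univ) (fun _ _ => Finset.mem_univ _)]
  refine (Finset.sum_le_sum (g := fun _ => d) fun i _ => ?_).trans (by simp)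
  refine le_trans (le_of_eq ?_) (hc v hv i)
  rw [Set.ncard_eq_toFinset_card']
  congr 1
  ext e
  simp

theorem defectiveChromaticIndex_le {k d : ℕ} (h : G.DefectiveEdgeColourable k d) :
    G.defectiveChromaticIndex d ≤ k :=
  iInf₂_le k h

theorem le_defectiveChromaticIndex {n d : ℕ} (h : ∀ k, G.DefectiveEdgeColourable k d → n ≤ k) :
    (n : ℕ∞) ≤ G.defectiveChromaticIndex d :=
  le_iInf₂ fun k hk => by exact_mod_cast h k hk

/-- The denominator is positive, so this is 3Δ − 1 ≤ k(3d − 1), rearranged to avoid subtraction in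
ℕ. -/
theorem ceil_le_iff {d Δ k : ℕ} (hd : 1 ≤ d) :
    ⌈(3 * (Δ : ℚ) - 1) / (3 * (d : ℚ) - 1)⌉₊ ≤ k ↔ 3 * Δ + k ≤ 3 * (k * d) + 1 := by
  have hdQ : (1 : ℚ) ≤ d := by exact_mod_cast hd
  rw [Nat.ceil_le, div_le_iff₀ (by linarith), ← Nat.cast_le (α := ℚ)]
  push_cast
  constructor <;> intro h <;> linarith

theorem defectiveChromaticIndex_le_ceil {α β : Type*} {G : Graph α β} [G.Loopless]
    (hV : G.vertexSet.Finite) (hE : G.edgeSet.Finite) {d Δ : ℕ} (hd : 1 ≤ d) (hΔ : 1 ≤ Δ)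
    (hG : G.HasMaxDegree Δ) :
    G.defectiveChromaticIndex d ≤ (⌈(3 * (Δ : ℚ) - 1) / (3 * (d : ℚ) - 1)⌉₊ : ℕ) := by
  have h := (ceil_le_iff (Δ := Δ) hd).1 le_rfl
  refine defectiveChromaticIndex_le (defectiveEdgeColourable hV hE hG h ?_)
  -- Zero colours would give 3Δ ≤ 1.
  by_contra! h0
  rw [Nat.lt_one_iff] at h0
  rw [h0] at h
  omega

end Transfer

section Shannon

theorem shannon_inc {k : ℕ} {e : Σ i : Fin 3, Fin (shannonMultiplicity k i)} {v : Fin 3} :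
    (shannon k).Inc e v ↔ v = e.1 ∨ v = e.1 + 1 := by
  change (∃ y, s(v, y) = s(e.1, e.1 + 1)) ↔ _
  simp only [Sym2.eq_iff]
  constructor
  · rintro ⟨y, ⟨h, -⟩ | ⟨h, -⟩⟩
    exacts [Or.inl h, Or.inr h]
  · rintro (h | h)
    exacts [⟨_, Or.inl ⟨h, rfl⟩⟩, ⟨_, Or.inr ⟨h, rfl⟩⟩]

theorem shannon_loopless (k : ℕ) : (shannon k).Loopless where
  not_isLoopAt e x h := by
    change s(x, x) = s(e.1, e.1 + 1) at h
    rw [Sym2.eq_iff] at h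
    have h' : e.1 = e.1 + 1 := by
      rcases h with ⟨h, h'⟩ | ⟨h, h'⟩
      exacts [h.symm.trans h', h'.symm.trans h]
    revert h'
    generalize e.1 = i
    decide +revert

theorem shannon_degree (k : ℕ) (v : Fin 3) :
    (shannon k).degree v = ∑ i, if v = i ∨ v = i + 1 then shannonMultiplicity k i else 0 := by
  have : {e | (shannon k).Inc e v} =
      ((Finset.univ.filter fun e : Σ i : Fin 3, Fin (shannonMultiplicity k i) =>
        v = e.1 ∨ v = e.1 + 1) : Set _) := by
    ext e
    simp [shannon_inc]
  rw [degree, this, Set.ncard_coe_finset, Finset.card_filter, Fintype.sum_sigma]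
  exact Finset.sum_congr rfl fun i _ => by split_ifs <;> simp

theorem shannon_hasMaxDegree (k : ℕ) : (shannon k).HasMaxDegree k := by
  have h : (shannon k).degree 0 = k := by
    rw [shannon_degree, Fin.sum_univ_three]
    simp [shannonMultiplicity]
    omega
  refine ⟨⟨0, Set.mem_univ _, h⟩, ?_⟩
  rintro _ ⟨v, -, rfl⟩
  rw [shannon_degree, Fin.sum_univ_three]
  fin_cases v <;> simp [shannonMultiplicity] <;> omega

/-- A colour class with defect `d` on three vertices has at most `3d / 2` edges. -/
theorem shannon_card_le {Δ k d : ℕ} (h : (shannon Δ).DefectiveEdgeColourable k d) :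
    Δ + Δ / 2 ≤ k * (3 * d / 2) := by
  classical
  obtain ⟨c', hc'⟩ := h
  let T := Σ i : Fin 3, Fin (shannonMultiplicity Δ i)
  let c : T → Fin k := fun e => c' ⟨e, Set.mem_univ _⟩
  have hc : ∀ v i, (Finset.univ.filter fun e : T => (v = e.1 ∨ v = e.1 + 1) ∧ c e = i).card ≤ d := by
    intro v i
    refine le_trans (le_of_eq ?_) (hc' v (Set.mem_univ _) i)
    rw [← Set.ncard_coe_finset, ← Set.ncard_image_of_injective _ Subtype.val_injective]
    congr 1
    ext e
    simp only [Finset.coe_filter, Finset.mem_univ, true_and, Set.mem_ofPred_eq, Set.mem_image,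
      shannon_inc]
    constructor
    · exact fun h => ⟨⟨e, Set.mem_univ _⟩, h, rfl⟩
    · rintro ⟨e, h, rfl⟩
      exact h
  have hclass : ∀ i, (Finset.univ.filter fun e : T => c e = i).card ≤ 3 * d / 2 := by
    intro i
    -- Each edge is seen from two of the three vertices, so twice the class size is at most 3d.
    have h2 : ∀ j : Fin 3, (∑ v, if v = j ∨ v = j + 1 then 1 else 0) = 2 := by decide
    have h3 := Finset.sum_le_sum fun v (_ : v ∈ Finset.univ) => hc v i
    have h4 : ∑ v : Fin 3, (Finset.univ.filter fun e : T =>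
        (v = e.1 ∨ v = e.1 + 1) ∧ c e = i).card =
        2 * (Finset.univ.filter fun e : T => c e = i).card := by
      simp only [Finset.card_filter]
      rw [Finset.sum_comm, Finset.mul_sum]
      refine Finset.sum_congr rfl fun e _ => ?_
      by_cases h : c e = i
      · simpa [h] using h2 e.1
      · simp [h]
    simp only [Finset.sum_const, Finset.card_univ, Fintype.card_fin, smul_eq_mul] at h3
    omega
  have hcard : Fintype.card T = Δ + Δ / 2 := by
    rw [Fintype.card_sigma, Fin.sum_univ_three]
    simp only [Fintype.card_fin]
    simp [shannonMultiplicity]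
    omega
  rw [← hcard, ← Finset.card_univ,
    Finset.card_eq_sum_card_fiberwise (f := c) (t := Finset.univ) (fun _ _ => Finset.mem_univ _)]
  exact (Finset.sum_le_sum fun i _ => hclass i).trans (by simp)

end Shannon

end Graph

/-! ### The main theorem -/

theorem theorem11p1p1 (d Δ : ℕ) (hd : 1 ≤ d) (hΔ : 1 ≤ Δ) :
    (Even d →
      ∀ {α : Type*} {β : Type*} (G : Graph α β) [G.Loopless],
        G.vertexSet.Finite → G.edgeSet.Finite → G.HasMaxDegree Δ →
          G.defectiveChromaticIndex d = (⌈(Δ : ℚ) / (d : ℚ)⌉₊ : ℕ)) ∧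
    (Odd d →
      (∀ {α : Type*} {β : Type*} (G : Graph α β) [G.Loopless],
        G.vertexSet.Finite → G.edgeSet.Finite → G.HasMaxDegree Δ →
          G.defectiveChromaticIndex d ≤
            (⌈(3 * (Δ : ℚ) - 1) / (3 * (d : ℚ) - 1)⌉₊ : ℕ)) ∧
      ((Graph.shannon Δ).Loopless ∧ (Graph.shannon Δ).HasMaxDegree Δ ∧
        (Graph.shannon Δ).defectiveChromaticIndex d =
          (⌈(3 * (Δ : ℚ) - 1) / (3 * (d : ℚ) - 1)⌉₊ : ℕ))) := by
  have hdQ : (1 : ℚ) ≤ d := by exact_mod_cast hd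
  have hceil : ∀ k : ℕ, ⌈(Δ : ℚ) / (d : ℚ)⌉₊ ≤ k ↔ Δ ≤ k * d := by
    intro k
    rw [Nat.ceil_le, div_le_iff₀ (by linarith)]
    exact_mod_cast Iff.rfl
  refine ⟨fun he α β G _ hV hE hG => le_antisymm ?_ ?_, fun ho => ⟨?_, ?_, ?_, ?_⟩⟩
  · exact Graph.defectiveChromaticIndex_le
      (Graph.defectiveEdgeColourable_of_even hV hE he hG ((hceil _).1 le_rfl))
  · refine Graph.le_defectiveChromaticIndex fun k hk => (hceil k).2 ?_
    obtain ⟨v, hv, h⟩ := hG.1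
    rw [← h]
    exact hk.degree_le hE hv
  · exact fun G _ hV hE hG => Graph.defectiveChromaticIndex_le_ceil hV hE hd hΔ hG
  · exact Graph.shannon_loopless Δ
  · exact Graph.shannon_hasMaxDegree Δ
  · have := Graph.shannon_loopless Δ
    refine le_antisymm ?_ ?_
    · exact Graph.defectiveChromaticIndex_le_ceil (Set.toFinite _) (Set.toFinite _) hd hΔ
        (Graph.shannon_hasMaxDegree Δ)
    · refine Graph.le_defectiveChromaticIndex fun k hk => (Graph.ceil_le_iff hd).2 ?_
      -- For odd d, ⌊3d/2⌋ = (3d − 1)/2, while 2(Δ + ⌊Δ/2⌋) ≥ 3Δ − 1; doubling the edge count gives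
      -- the bound.
      have h := Graph.shannon_card_le hk
      obtain ⟨m, rfl⟩ := ho
      rw [show 3 * (2 * m + 1) / 2 = 3 * m + 1 by omega] at h
      have : k * (2 * m + 1) = 2 * (k * m) + k := by ring
      have : k * (3 * m + 1) = 3 * (k * m) + k := by ring
      omega
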